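/- A hemiring is an algebra $(R,+,\cdot,0)$ such that $(R,+,0)$ is a commutative monoid, $(R,\cdot)$ is a semigroup, multiplication distributes over addition on both sides, and $0r=0=r0$ for all $r\in R$. A congruence on $R$ is an equivalence relation compatible with $+$ and $\cdot$; $R$ is congruence-simple if the diagonal and $R\times R$ are its only congruences. A right ideal $I$ of $R$ is right semiregular if for all $i_1,i_2\in I$ there are $j_1,j_2\in I$ with $i_1+j_1+i_1j_1+i_2j_2=i_2+j_2+i_1j_2+i_2j_1$. The Jacobson radical $J(R)$ is the sum of all right semiregular right ideals of $R$; $R$ is $J$-radical if $J(R)=R$ and $J$-semisimple if $J(R)=0$. A left $R$-semimodule is a commutative monoid $(M,+,0)$ with a scalar multiplication $R\times M\to M$ that is additive in each variable and satisfies $(rr')m=r(r'm)$ and $r0=0=0m$. It is irreducible if it is nonzero, cancellative ($x+z=y+z$ implies $x=y$), and for all $m_1\neq m_2$ in $M$ and all $m\in M$ there are $r_1,r_2\in R$ with $m+r_1m_1+r_2m_2=r_1m_2+r_2m_1$. It is faithful if $r=0$ is the only $r\in R$ with $rM=0$. A hemiring is primitive if it has a faithful irreducible left semimodule. Theorem 3.10.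 (i) If $R$ is a congruence-simple hemiring, then $R$ is $J$-radical or primitive. (ii) A nonzero $J$-semisimple hemiring $R$ is congruence-simple if and only if $R$ is a simple ring, that is, $(R,+,\cdot,0)$ is a (not necessarily unital) ring, nonzero, whose only two-sided ideals are $0$ and $R$. -/

import Mathlib

namespace Hemiring

universe u v

/-! A hemiring is Mathlib's `NonUnitalSemiring`: a commutative additive monoid with an associative,
distributive multiplication for which `0` is absorbing; no multiplicative identity is assumed. -/

/-- Left semimodules over a hemiring. -/
class LeftSemimodule (R : Type u) (M : Type v) [NonUnitalSemiring R] [AddCommMonoid M]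
    extends SMul R M where
  mul_smul : ∀ (r s : R) (m : M), (r * s) • m = r • (s • m)
  smul_add : ∀ (r : R) (m n : M), r • (m + n) = r • m + r • n
  add_smul : ∀ (r s : R) (m : M), (r + s) • m = r • m + s • m
  smul_zero : ∀ r : R, r • (0 : M) = 0
  zero_smul : ∀ m : M, (0 : R) • m = 0

/-- A nonzero cancellative left semimodule `M` is irreducible if for all `m₁ ≠ m₂` and all `m`
there are `r₁, r₂` with `m + r₁m₁ + r₂m₂ = r₁m₂ + r₂m₁`. -/
structure IsIrreducible (R : Type u) (M : Type v) [NonUnitalSemiring R] [AddCommMonoid M]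
    [LeftSemimodule R M] : Prop where
  nonzero : ∃ m : M, m ≠ 0
  cancellative : ∀ x y z : M, x + z = y + z → x = y
  exists_smul : ∀ m₁ m₂ : M, m₁ ≠ m₂ → ∀ m : M,
    ∃ r₁ r₂ : R, m + r₁ • m₁ + r₂ • m₂ = r₁ • m₂ + r₂ • m₁

/-- A left semimodule is faithful if its annihilator `{r | rM = 0}` is zero. -/
def IsFaithful (R : Type u) (M : Type v) [NonUnitalSemiring R] [AddCommMonoid M]
    [LeftSemimodule R M] : Prop :=
  ∀ r : R, (∀ m : M, r • m = 0) → r = 0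

/-- A hemiring is primitive if it has a faithful irreducible left semimodule. -/
def IsPrimitive (R : Type u) [NonUnitalSemiring R] : Prop :=
  ∃ (M : Type u) (_ : AddCommMonoid M) (_ : LeftSemimodule R M),
    IsIrreducible R M ∧ IsFaithful R M

/-- Right ideals of a hemiring: additive submonoids closed under right multiplication by `R`. -/
def IsRightIdeal {R : Type u} [NonUnitalSemiring R] (I : AddSubmonoid R) : Prop :=
  ∀ i ∈ I, ∀ r : R, i * r ∈ I

/-- Bourne's right semiregularity. -/
def IsRightSemiregular {R : Type u} [NonUnitalSemiring R] (I : AddSubmonoid R) : Prop :=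
  ∀ i₁ ∈ I, ∀ i₂ ∈ I, ∃ j₁ ∈ I, ∃ j₂ ∈ I,
    i₁ + j₁ + i₁ * j₁ + i₂ * j₂ = i₂ + j₂ + i₁ * j₂ + i₂ * j₁

/-- The Jacobson(-Bourne) radical: the sum of all right semiregular right ideals. -/
def jacobson (R : Type u) [NonUnitalSemiring R] : AddSubmonoid R :=
  sSup {I : AddSubmonoid R | IsRightIdeal I ∧ IsRightSemiregular I}

/-- `R` is `J`-radical if `J(R) = R`. -/
def IsJRadical (R : Type u) [NonUnitalSemiring R] : Prop := jacobson R = ⊤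

/-- `R` is `J`-semisimple if `J(R) = 0`. -/
def IsJSemisimple (R : Type u) [NonUnitalSemiring R] : Prop := jacobson R = ⊥

/-- `R` is congruence-simple if the diagonal and the universal congruence are its only
congruences (`RingCon R`: equivalence relations compatible with `+` and `*`). -/
def IsCongruenceSimple (R : Type u) [NonUnitalSemiring R] : Prop :=
  ∀ c : RingCon R, c = ⊥ ∨ c = ⊤

/-- The hemiring `R` is a simple ring: its operations are those of a (not necessarily unital) ring
that is simple, i.e. nonzero with no two-sided ideals besides `0` and the whole ring. -/
def IsASimpleRing (R : Type u) [h : NonUnitalSemiring R] : Prop :=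
  ∃ S : NonUnitalRing R, S.toNonUnitalSemiring = h ∧ @IsSimpleRing R S.toNonUnitalNonAssocRing

end Hemiring

/-! Test congruence-simplicity on `cancellationCon`. If it is universal, any two elements agree
after adding a common summand, and all of `R` is right semiregular. If it is the diagonal, `R`
embeds in its ring of differences `D`. When every element of `D` is left quasi-regular, the
quasi-inverses make `R` right semiregular. Otherwise some `1 + d` lies in a maximal left ideal of
the unitization of `D`; the quotient is irreducible over `R`, and faithful because `actionCon`
cannot be universal. For (ii), semisimplicity excludes the universal case, so `R` is cancellative;
`invertibleCon` and `archimedeanCon` then force `(R,+)` to be a group, and congruences of a ring are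
its two-sided ideals. -/

namespace Hemiring

universe u

/-! ### Test congruences; additive inverses. -/

section Congruences

variable {R : Type u} [NonUnitalSemiring R]

/-- The least congruence with additively cancellative quotient. -/
def cancellationCon (R : Type u) [NonUnitalSemiring R] : RingCon R where
  r a b := ∃ z, a + z = b + z
  iseqv := ⟨fun _ => ⟨0, rfl⟩, fun ⟨z, h⟩ => ⟨z, h.symm⟩, by
    rintro a b c ⟨z, h⟩ ⟨w, k⟩
    refine ⟨z + w, ?_⟩
    rw [← add_assoc, h, add_right_comm, k, add_assoc, add_comm w z]⟩
  add' := by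
    rintro a b c d ⟨z, h⟩ ⟨w, k⟩
    exact ⟨z + w, by rw [add_add_add_comm, h, k, add_add_add_comm]⟩
  mul' := by
    rintro a b c d ⟨z, h⟩ ⟨w, k⟩
    refine ⟨z * c + b * w, ?_⟩
    calc a * c + (z * c + b * w) = (a + z) * c + b * w := by rw [add_mul, add_assoc]
      _ = b * (c + w) + z * c := by rw [h, add_mul, mul_add]; abel
      _ = b * d + (z * c + b * w) := by rw [k, mul_add]; abel

/-- The Bourne congruence of the ideal of additively invertible elements. -/
def invertibleCon (R : Type u) [NonUnitalSemiring R] : RingCon R where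
  r a b := ∃ v, IsAddUnit v ∧ a = b + v
  iseqv := ⟨fun _ => ⟨0, isAddUnit_zero, (add_zero _).symm⟩, by
    rintro a b ⟨v, hv, rfl⟩
    obtain ⟨w, hw⟩ := hv.exists_neg
    exact ⟨w, .of_add_eq_zero v (by rw [add_comm, hw]), by rw [add_assoc, hw, add_zero]⟩, by
    rintro a b c ⟨v, hv, rfl⟩ ⟨w, hw, rfl⟩
    exact ⟨w + v, hw.add hv, add_assoc _ _ _⟩⟩
  add' := by
    rintro a b c d ⟨v, hv, rfl⟩ ⟨w, hw, rfl⟩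
    exact ⟨v + w, hv.add hw, add_add_add_comm _ _ _ _⟩
  mul' := by
    rintro a b c d ⟨v, hv, rfl⟩ ⟨w, hw, rfl⟩
    refine ⟨b * w + v * (d + w), ((hw.map (AddMonoidHom.mulLeft b))).add
      (hv.map (AddMonoidHom.mulRight (d + w))), ?_⟩
    rw [add_mul, mul_add, add_assoc]

/-- The congruence whose classes are the archimedean classes of the natural preorder. -/
def archimedeanCon (R : Type u) [NonUnitalSemiring R] : RingCon R where
  r a b := (∃ (n : ℕ) (z : R), a + z = n • b) ∧ ∃ (n : ℕ) (z : R), b + z = n • a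
  iseqv := by
    have trans : ∀ a b c : R, (∃ (n : ℕ) (z : R), a + z = n • b) →
        (∃ (n : ℕ) (z : R), b + z = n • c) → ∃ (n : ℕ) (z : R), a + z = n • c := by
      rintro a b c ⟨n, z, h⟩ ⟨m, w, k⟩
      exact ⟨n * m, z + n • w, by rw [← add_assoc, h, ← nsmul_add, k, mul_nsmul']⟩
    exact ⟨fun a => ⟨⟨1, 0, by simp⟩, ⟨1, 0, by simp⟩⟩, fun h => ⟨h.2, h.1⟩,
      fun h k => ⟨trans _ _ _ h.1 k.1, trans _ _ _ k.2 h.2⟩⟩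
  add' := by
    have add : ∀ a b c d : R, (∃ (n : ℕ) (z : R), a + z = n • b) →
        (∃ (n : ℕ) (z : R), c + z = n • d) → ∃ (n : ℕ) (z : R), a + c + z = n • (b + d) := by
      rintro a b c d ⟨n, z, h⟩ ⟨m, w, k⟩
      refine ⟨n + m, (z + m • b) + (w + n • d), ?_⟩
      calc a + c + (z + m • b + (w + n • d)) = (a + z) + m • b + ((c + w) + n • d) := by abel
        _ = (n + m) • (b + d) := by rw [h, k, add_nsmul, nsmul_add, nsmul_add]; abel
    intro _ _ _ _ h k
    exact ⟨add _ _ _ _ h.1 k.1, add _ _ _ _ h.2 k.2⟩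
  mul' := by
    have mul : ∀ a b c d : R, (∃ (n : ℕ) (z : R), a + z = n • b) →
        (∃ (n : ℕ) (z : R), c + z = n • d) → ∃ (n : ℕ) (z : R), a * c + z = n • (b * d) := by
      rintro a b c d ⟨n, z, h⟩ ⟨m, w, k⟩
      refine ⟨n * m, a * w + z * (m • d), ?_⟩
      rw [← add_assoc, ← mul_add, k, ← add_mul, h, smul_mul_assoc, mul_smul_comm, mul_nsmul']
    intro _ _ _ _ h k
    exact ⟨mul _ _ _ _ h.1 k.1, mul _ _ _ _ h.2 k.2⟩

theorem isAddUnit_of_isCongruenceSimple [IsCancelAdd R] (h : IsCongruenceSimple R) (a : R) :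
    IsAddUnit a := by
  rcases h (invertibleCon R) with h₁ | h₁
  · have unit_eq_zero : ∀ v : R, IsAddUnit v → v = 0 := fun v hv => by
      have : (invertibleCon R) v 0 := ⟨v, hv, (zero_add v).symm⟩
      rwa [h₁] at this
    suffices a = 0 from this ▸ isAddUnit_zero
    -- `a` and `a + a` are always archimedean equivalent, while `a` equivalent to `0` means that `a`
    -- is invertible; either way `a = 0`.
    rcases h (archimedeanCon R) with h₂ | h₂
    · have : (archimedeanCon R) a (a + a) :=
        ⟨⟨1, a, by simp⟩, ⟨2, 0, by simp [two_nsmul]⟩⟩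
      rw [h₂] at this
      exact (left_eq_add.1 (show a = a + a from this))
    · have : (archimedeanCon R) a 0 := by rw [h₂]; trivial
      obtain ⟨⟨n, z, hz⟩, -⟩ := this
      rw [smul_zero] at hz
      exact unit_eq_zero a (.of_add_eq_zero z hz)
  · have : (invertibleCon R) a 0 := by rw [h₁]; trivial
    obtain ⟨v, hv, rfl⟩ := this
    rwa [zero_add]

theorem isASimpleRing_of_isCongruenceSimple {R : Type u} [h : NonUnitalSemiring R] [Nontrivial R]
    (hs : IsCongruenceSimple R) (hunit : ∀ a : R, IsAddUnit a) : IsASimpleRing R := by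
  choose f hf using fun a => (hunit a).exists_neg'
  -- All of `h`'s data, `nsmul` included, is reused, so forgetting negation returns `h`
  -- definitionally.
  let G : AddGroup R :=
    { h with
      neg := f
      zsmul := @zsmulRec R _ _ ⟨f⟩ h.nsmul
      zsmul_zero' := h.nsmul_zero
      zsmul_succ' := h.nsmul_succ
      zsmul_neg' := fun _ _ => rfl
      neg_add_cancel := hf }
  let S : NonUnitalRing R := { h, G with }
  refine ⟨S, rfl, ⟨?_⟩⟩
  refine { exists_pair_ne := ⟨⟨⊥⟩, ⟨⊤⟩, fun e => ?_⟩, eq_bot_or_eq_top := fun I => ?_ }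
  · obtain ⟨x, y, hxy⟩ := exists_pair_ne R
    have e' : (⊥ : RingCon R) = ⊤ := congrArg TwoSidedIdeal.ringCon e
    have : (⊥ : RingCon R) x y := by rw [e']; trivial
    exact hxy this
  · rcases hs I.ringCon with e | e
    · exact .inl (congrArg TwoSidedIdeal.ofRingCon e)
    · exact .inr (congrArg TwoSidedIdeal.ofRingCon e)

theorem IsASimpleRing.isCongruenceSimple {R : Type u} [NonUnitalSemiring R]
    (h : IsASimpleRing R) : IsCongruenceSimple R := by
  obtain ⟨S, rfl, hS⟩ := h
  intro c
  rcases hS.simple.eq_bot_or_eq_top (.ofRingCon c) with e | e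
  · exact .inl (congrArg TwoSidedIdeal.ringCon e)
  · exact .inr (congrArg TwoSidedIdeal.ringCon e)

end Congruences

/-! ### The ring of differences. -/

section DifferenceRing

open Algebra

variable (R : Type u) [NonUnitalSemiring R]

/-- The ring of differences of a hemiring. -/
def DifferenceRing : Type u := GrothendieckAddGroup R

namespace DifferenceRing

noncomputable instance : AddCommGroup (DifferenceRing R) :=
  inferInstanceAs (AddCommGroup (GrothendieckAddGroup R))

variable {R}

/-- The canonical additive map into the ring of differences. -/
noncomputable def of : R →+ DifferenceRing R := GrothendieckAddGroup.of

theorem exists_eq_sub (x : DifferenceRing R) : ∃ a b : R, x = of a - of b := by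
  induction x using AddLocalization.ind with
  | H y =>
    obtain ⟨a, b, hb⟩ := y
    refine ⟨a, b, ?_⟩
    refine eq_sub_of_add_eq ?_
    exact (AddLocalization.addMonoidOf (⊤ : AddSubmonoid R)).mk'_spec a ⟨b, hb⟩ ▸ by
      rw [AddLocalization.mk_eq_addMonoidOf_mk']; rfl

theorem of_injective [IsCancelAdd R] : Function.Injective (of (R := R)) :=
  GrothendieckAddGroup.of_injective

theorem addHom_ext {G : Type*} [AddCommGroup G] {f g : DifferenceRing R →+ G}
    (h : ∀ a, f (of a) = g (of a)) : f = g := by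
  ext x
  obtain ⟨a, b, rfl⟩ := exists_eq_sub x
  rw [map_sub, map_sub, h, h]

/-- Extend an additive map to the ring of differences. -/
noncomputable def lift {G : Type*} [AddCommGroup G] (f : R →+ G) : DifferenceRing R →+ G :=
  GrothendieckAddGroup.lift f

theorem lift_of {G : Type*} [AddCommGroup G] (f : R →+ G) (a : R) : lift f (of a) = f a :=
  DFunLike.congr_fun (GrothendieckAddGroup.lift.symm_apply_apply f) a

/-- Multiplication on the ring of differences as a biadditive map. -/
noncomputable def mulHom : DifferenceRing R →+ DifferenceRing R →+ DifferenceRing R :=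
  lift
    { toFun := fun a => lift (of.comp (AddMonoidHom.mulLeft a))
      map_zero' := addHom_ext fun b => by simp [lift_of]
      map_add' := fun a b => addHom_ext fun c => by simp [lift_of, add_mul] }

noncomputable instance : Mul (DifferenceRing R) := ⟨fun x y => mulHom x y⟩

theorem mul_def (x y : DifferenceRing R) : x * y = mulHom x y := rfl

theorem of_mul (a b : R) : of (a * b) = of a * of b := by
  simp [mul_def, mulHom, lift_of]

noncomputable instance : NonUnitalNonAssocRing (DifferenceRing R) :=
  { (inferInstance : AddCommGroup (DifferenceRing R)),
    (inferInstance : Mul (DifferenceRing R)) with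
    left_distrib := fun x y z => by simp only [mul_def, map_add]
    right_distrib := fun x y z => by simp only [mul_def, map_add, AddMonoidHom.add_apply]
    zero_mul := fun x => by simp only [mul_def, map_zero, AddMonoidHom.zero_apply]
    mul_zero := fun x => by simp only [mul_def, map_zero] }

noncomputable instance : NonUnitalRing (DifferenceRing R) :=
  { (inferInstance : NonUnitalNonAssocRing (DifferenceRing R)) with
    mul_assoc := fun x y z => by
      obtain ⟨a, b, rfl⟩ := exists_eq_sub x
      obtain ⟨c, d, rfl⟩ := exists_eq_sub y
      obtain ⟨e, f, rfl⟩ := exists_eq_sub z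
      simp only [sub_mul, mul_sub, ← of_mul, mul_assoc] }

end DifferenceRing

end DifferenceRing

/-! ### Quasi-regularity and simple modules. -/

section QuasiRegular

variable {D : Type u} [NonUnitalRing D]

/-- The ring obtained from a nonunital ring by adjoining an identity. -/
def IntUnitization (D : Type u) [NonUnitalRing D] : Type u := Unitization ℤ D

namespace IntUnitization

noncomputable instance : Ring (IntUnitization D) := inferInstanceAs (Ring (Unitization ℤ D))

/-- The inclusion of a nonunital ring in its unitization. -/
noncomputable def inr : D →ₙ+* IntUnitization D where
  toFun := (Unitization.inr : D → Unitization ℤ D)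
  map_mul' := Unitization.inr_mul ℤ
  map_zero' := Unitization.inr_zero ℤ
  map_add' := Unitization.inr_add ℤ

theorem exists_mul_inr_eq (u : IntUnitization D) (x : D) : ∃ y : D, u * inr x = inr y :=
  ⟨u.toProd.1 • x + u.toProd.2 * x, Unitization.ext (mul_zero u.toProd.1) <| congrArg (· + _) <|
    show u.toProd.1 • x + (0 : ℤ) • u.toProd.2 = _ by rw [zero_smul, add_zero]⟩

theorem exists_inr_mul_eq (u : IntUnitization D) (x : D) : ∃ y : D, inr x * u = inr y :=
  ⟨u.toProd.1 • x + x * u.toProd.2, Unitization.ext (zero_mul u.toProd.1) <| congrArg (· + _) <|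
    show (0 : ℤ) • u.toProd.2 + u.toProd.1 • x = _ by rw [zero_smul, zero_add]⟩

/-- The integer component forces `u = 1 + y`; the `D`-component is then the claim. -/
theorem exists_left_quasiInverse {u : IntUnitization D} {d : D} (h : u * (1 + inr d) = 1) :
    ∃ y : D, y + d + y * d = 0 := by
  have h₁ : u.toProd.1 = 1 := by
    have : u.toProd.1 * (1 + 0) = 1 := congrArg (fun v : Unitization ℤ D => v.toProd.1) h
    simpa using this
  have h₂ : u.toProd.1 • (0 + d) + (1 + 0 : ℤ) • u.toProd.2 + u.toProd.2 * (0 + d) = 0 :=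
    congrArg (fun v : Unitization ℤ D => v.toProd.2) h
  rw [h₁, zero_add, add_zero, one_smul, one_smul] at h₂
  exact ⟨u.toProd.2, by rw [← h₂]; abel⟩

end IntUnitization

/-- An element that is not left quasi-regular gives rise to a simple module over the
unitization on which the ring acts nontrivially. -/
theorem exists_isMaximal_inr_notMem {d : D} (hd : ∀ y : D, y + d + y * d ≠ 0) :
    ∃ M : Ideal (IntUnitization D), M.IsMaximal ∧ ∃ a : D, IntUnitization.inr a ∉ M := by
  have hne : Ideal.span {1 + IntUnitization.inr d} ≠ ⊤ := by
    intro h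
    obtain ⟨u, hu⟩ := Ideal.mem_span_singleton'.1 ((Ideal.eq_top_iff_one _).1 h)
    obtain ⟨y, hy⟩ := IntUnitization.exists_left_quasiInverse hu
    exact hd y hy
  obtain ⟨M, hM, hle⟩ := Ideal.exists_le_maximal _ hne
  refine ⟨M, hM, d, fun hdM => hM.ne_top ((Ideal.eq_top_iff_one M).2 ?_)⟩
  have := M.sub_mem (hle (Ideal.mem_span_singleton_self _)) hdM
  rwa [add_sub_cancel_right] at this

/-- In a simple module over the unitization on which the ring `D` acts nontrivially, every nonzero
element generates already under the action of `D`. -/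
theorem exists_inr_smul_eq {N : Type*} [AddCommGroup N] [Module (IntUnitization D) N]
    [IsSimpleModule (IntUnitization D) N] {a : D} {n₀ : N}
    (h₀ : IntUnitization.inr a • n₀ ≠ 0) {n : N} (hn : n ≠ 0) (m : N) :
    ∃ x : D, IntUnitization.inr x • n = m := by
  let orbit : N → Submodule (IntUnitization D) N := fun n =>
    { carrier := {m | ∃ x : D, IntUnitization.inr x • n = m}
      zero_mem' := ⟨0, by simp⟩
      add_mem' := by
        rintro _ _ ⟨x, rfl⟩ ⟨y, rfl⟩
        exact ⟨x + y, by rw [map_add, add_smul]⟩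
      smul_mem' := by
        rintro u _ ⟨x, rfl⟩
        obtain ⟨y, hy⟩ := IntUnitization.exists_mul_inr_eq u x
        exact ⟨y, by rw [smul_smul, hy]⟩ }
  let killed : Submodule (IntUnitization D) N :=
    { carrier := {m | ∀ x : D, IntUnitization.inr x • m = 0}
      zero_mem' := fun x => smul_zero _
      add_mem' := fun {p q} hp hq x => by rw [smul_add, hp, hq, add_zero]
      smul_mem' := fun u m hm x => by
        obtain ⟨y, hy⟩ := IntUnitization.exists_inr_mul_eq u x
        rw [smul_smul, hy, hm] }
  have hk : killed = ⊥ := (eq_bot_or_eq_top killed).resolve_right fun h =>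
    h₀ ((h ▸ Submodule.mem_top : n₀ ∈ killed) a)
  -- A zero orbit would put `n` in `killed`, which is zero.
  have ho : orbit n = ⊤ := (eq_bot_or_eq_top (orbit n)).resolve_left fun h => hn <| by
    have : n ∈ killed := fun x => by
      have : IntUnitization.inr x • n ∈ orbit n := ⟨x, rfl⟩
      rwa [h, Submodule.mem_bot] at this
    rwa [hk, Submodule.mem_bot] at this
  exact (ho ▸ Submodule.mem_top : m ∈ orbit n)

/-- For the associative operation `a ∘ b = a + b + a * b` with unit `0`, left inverses everywhere
are two-sided. `h₃` is `(z ∘ y) ∘ d = z ∘ (y ∘ d)` with `d` moved across. -/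
theorem exists_right_quasiInverse (h : ∀ d : D, ∃ y : D, y + d + y * d = 0) (d : D) :
    ∃ y : D, d + y + d * y = 0 := by
  obtain ⟨y, hy⟩ := h d
  obtain ⟨z, hz⟩ := h y
  suffices z = d from ⟨y, this ▸ hz⟩
  have h₁ : z * (y + d + y * d) = 0 := by rw [hy, mul_zero]
  have h₂ : (z + y + z * y) * d = 0 := by rw [hz, zero_mul]
  have h₃ : (z + y + z * y) + (z + y + z * y) * d = (y + d + y * d) + z * (y + d + y * d)
      + (z - d) := by
    simp only [add_mul, mul_add, mul_assoc]
    abel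
  rw [h₁, h₂, hz, hy, add_zero, zero_add] at h₃
  exact sub_eq_zero.1 h₃.symm

end QuasiRegular

/-! ### Radical or primitive. -/

section Radical

variable {R : Type u} [NonUnitalSemiring R]

theorem isJRadical_of_isRightSemiregular_top
    (h : IsRightSemiregular (⊤ : AddSubmonoid R)) : IsJRadical R :=
  top_le_iff.1 (le_sSup ⟨fun _ _ _ => trivial, h⟩)

theorem isJRadical_of_cancellationCon_eq_top (h : cancellationCon R = ⊤) : IsJRadical R := by
  refine isJRadical_of_isRightSemiregular_top fun i₁ _ i₂ _ => ?_
  have : (cancellationCon R) (i₁ * i₂ + i₂ * i₁) (i₁ * i₁ + i₂ * i₂) := by rw [h]; trivial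
  obtain ⟨x, hx⟩ := this
  -- With this choice the two sides differ only in the quadratic terms equated by `hx`; its summand
  -- `x` comes from the linear terms.
  refine ⟨i₂ + x, trivial, i₁ + x, trivial, ?_⟩
  calc i₁ + (i₂ + x) + i₁ * (i₂ + x) + i₂ * (i₁ + x)
      = (i₁ * i₂ + i₂ * i₁ + x) + (i₁ + i₂ + i₁ * x + i₂ * x) := by
        simp only [mul_add]; abel
    _ = i₂ + (i₁ + x) + i₁ * (i₁ + x) + i₂ * (i₂ + x) := by
        rw [hx]; simp only [mul_add]; abel

theorem isCancelAdd_of_cancellationCon_eq_bot (h : cancellationCon R = ⊥) : IsCancelAdd R :=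
  have : IsRightCancelAdd R := ⟨fun z a b hab => by
    have : (cancellationCon R) a b := ⟨z, hab⟩
    rwa [h] at this⟩
  AddCommMagma.IsRightCancelAdd.toIsCancelAdd R

/-- Semiregularity is `d + y + d * y = 0` for `d = i₁ - i₂`, `y = j₁ - j₂`, with negative terms
moved across. -/
theorem isJRadical_of_quasiRegular [IsCancelAdd R]
    (h : ∀ d : DifferenceRing R, ∃ y, d + y + d * y = 0) : IsJRadical R := by
  refine isJRadical_of_isRightSemiregular_top fun i₁ _ i₂ _ => ?_
  obtain ⟨y, hy⟩ := h (DifferenceRing.of i₁ - DifferenceRing.of i₂)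
  obtain ⟨j₁, j₂, rfl⟩ := DifferenceRing.exists_eq_sub y
  refine ⟨j₁, trivial, j₂, trivial, DifferenceRing.of_injective ?_⟩
  simp only [map_add, DifferenceRing.of_mul]
  rw [← sub_eq_zero, ← hy]
  simp only [mul_sub, sub_mul]
  abel

/-- A module over the unitization of the ring of differences, viewed as a semimodule. -/
noncomputable abbrev semimoduleOfUnitization (N : Type u) [AddCommGroup N]
    [Module (IntUnitization (DifferenceRing R)) N] : LeftSemimodule R N where
  smul r n := IntUnitization.inr (DifferenceRing.of r) • n
  mul_smul r s n := by
    change IntUnitization.inr (DifferenceRing.of (r * s)) • n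
      = IntUnitization.inr (DifferenceRing.of r) • IntUnitization.inr (DifferenceRing.of s) • n
    rw [DifferenceRing.of_mul, map_mul, mul_smul]
  smul_add r m n := smul_add (IntUnitization.inr (DifferenceRing.of r)) m n
  add_smul r s n := by
    change IntUnitization.inr (DifferenceRing.of (r + s)) • n
      = IntUnitization.inr (DifferenceRing.of r) • n + IntUnitization.inr (DifferenceRing.of s) • n
    rw [map_add, map_add, add_smul]
  smul_zero r := smul_zero (IntUnitization.inr (DifferenceRing.of r))
  zero_smul n := by
    change IntUnitization.inr (DifferenceRing.of (0 : R)) • n = 0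
    rw [map_zero, map_zero, zero_smul]

/-- The congruence identifying elements that act equally on a semimodule. -/
def actionCon (R N : Type u) [NonUnitalSemiring R] [AddCommMonoid N] [LeftSemimodule R N] :
    RingCon R where
  r a b := ∀ n : N, a • n = b • n
  iseqv := ⟨fun _ _ => rfl, fun h n => (h n).symm, fun h k n => (h n).trans (k n)⟩
  add' h k n := by rw [LeftSemimodule.add_smul, LeftSemimodule.add_smul, h, k]
  mul' h k n := by rw [LeftSemimodule.mul_smul, LeftSemimodule.mul_smul, k, h]

theorem IsIrreducible.isPrimitive {N : Type u} [AddCommMonoid N] [LeftSemimodule R N]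
    (hN : IsIrreducible R N) (h : IsCongruenceSimple R) : IsPrimitive R := by
  refine ⟨N, inferInstance, inferInstance, hN, fun r hr => ?_⟩
  rcases h (actionCon R N) with e | e
  · have : (actionCon R N) r 0 := fun n => by rw [hr, LeftSemimodule.zero_smul]
    rwa [e] at this
  · have act : ∀ (s : R) (n : N), s • n = 0 := fun s n => by
      have : (actionCon R N) s 0 := by rw [e]; trivial
      rw [this n, LeftSemimodule.zero_smul]
    obtain ⟨n, hn⟩ := hN.nonzero
    -- Under zero action the irreducibility identity collapses to `n = 0`.
    obtain ⟨r₁, r₂, h'⟩ := hN.exists_smul n 0 hn n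
    simp only [act, add_zero] at h'
    exact absurd h' hn

theorem exists_isIrreducible {d : DifferenceRing R} (hd : ∀ y, y + d + y * d ≠ 0) :
    ∃ (N : Type u) (_ : AddCommMonoid N) (_ : LeftSemimodule R N), IsIrreducible R N := by
  obtain ⟨M, hM, a, ha⟩ := exists_isMaximal_inr_notMem hd
  let A := IntUnitization (DifferenceRing R)
  have : IsSimpleModule A (A ⧸ M) := isSimpleModule_iff_isCoatom.2 hM.out
  have h₀ : IntUnitization.inr a • (Submodule.Quotient.mk 1 : A ⧸ M) ≠ 0 := by
    rw [← Submodule.Quotient.mk_smul, smul_eq_mul, mul_one]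
    exact fun h => ha ((Submodule.Quotient.mk_eq_zero M).1 h)
  let this : LeftSemimodule R (A ⧸ M) := semimoduleOfUnitization (A ⧸ M)
  refine ⟨A ⧸ M, inferInstance, this, ⟨_, h₀⟩,
    fun x y z h => add_right_cancel h, fun m₁ m₂ hne m => ?_⟩
  -- The required identity says `(r₁ - r₂) • (m₂ - m₁) = m`.
  obtain ⟨x, hx⟩ := exists_inr_smul_eq h₀ (sub_ne_zero.2 hne.symm) m
  obtain ⟨r₁, r₂, rfl⟩ := DifferenceRing.exists_eq_sub x
  refine ⟨r₁, r₂, ?_⟩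
  change m + IntUnitization.inr (DifferenceRing.of r₁) • m₁
      + IntUnitization.inr (DifferenceRing.of r₂) • m₂
    = IntUnitization.inr (DifferenceRing.of r₁) • m₂
      + IntUnitization.inr (DifferenceRing.of r₂) • m₁
  rw [← hx, map_sub, sub_smul, smul_sub, smul_sub]
  abel

theorem IsCongruenceSimple.isJRadical_or_isPrimitive (h : IsCongruenceSimple R) :
    IsJRadical R ∨ IsPrimitive R := by
  rcases h (cancellationCon R) with e | e
  · have := isCancelAdd_of_cancellationCon_eq_bot e
    by_cases hq : ∀ d : DifferenceRing R, ∃ y, y + d + y * d = 0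
    · exact .inl (isJRadical_of_quasiRegular (exists_right_quasiInverse hq))
    · push Not at hq
      obtain ⟨d, hd⟩ := hq
      obtain ⟨N, _, _, hN⟩ := exists_isIrreducible hd
      exact .inr (hN.isPrimitive h)
  · exact .inl (isJRadical_of_cancellationCon_eq_top e)

theorem IsCongruenceSimple.isASimpleRing [Nontrivial R] (hJ : IsJSemisimple R)
    (h : IsCongruenceSimple R) : IsASimpleRing R := by
  rcases h (cancellationCon R) with e | e
  · have := isCancelAdd_of_cancellationCon_eq_bot e
    exact isASimpleRing_of_isCongruenceSimple h (isAddUnit_of_isCongruenceSimple h)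
  · exact absurd (hJ.symm.trans (isJRadical_of_cancellationCon_eq_top e)) bot_ne_top

end Radical

end Hemiring

theorem theorem3p10 (R : Type*) [NonUnitalSemiring R] :
    (Hemiring.IsCongruenceSimple R → Hemiring.IsJRadical R ∨ Hemiring.IsPrimitive R) ∧
    (Nontrivial R → Hemiring.IsJSemisimple R →
      (Hemiring.IsCongruenceSimple R ↔ Hemiring.IsASimpleRing R)) :=
  ⟨fun h => h.isJRadical_or_isPrimitive,
    fun _ hJ => ⟨fun h => h.isASimpleRing hJ, fun h => h.isCongruenceSimple⟩⟩
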